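/- **Setting.** Let $k\ge 1$, $\boldsymbol\alpha=(\alpha_1,\dots,\alpha_k)\in(0,\infty)^k$, $\beta\in(0,\infty)$ and $\alpha_0=\sum_{i=1}^k\alpha_i$. The (Mathai–Moschopoulos) multivariate Gamma distribution $\mathcal{MG}_k(\boldsymbol\alpha,\beta)$ is the distribution on $\mathbb R^k$ with Lebesgue density $$f(\mathbf x)=\frac{1}{\beta^{\alpha_0}\prod_{i=1}^k\Gamma(\alpha_i)}\,e^{-x_k/\beta}\,x_1^{\alpha_1-1}\prod_{i=2}^k(x_i-x_{i-1})^{\alpha_i-1}\,\mathbb I_{\mathbf S}(\mathbf x),\qquad \mathbf S=\{\mathbf x\in(0,\infty)^k: x_1<\dots<x_k\}.$$ Write $\Delta\mathbf x=(x_1,x_2-x_1,\dots,x_k-x_{k-1})$, $\psi=\frac{d}{da}\log\Gamma(a)$, and let a bar denote the average over a sample of size $n$. Let $\boldsymbol\Theta=(0,\infty)^{k}\times(0,\infty)$ and $\boldsymbol\theta=(\boldsymbol\alpha,\beta)$; for a function $h$ on $\mathbf S$ with values in $\mathbb R^m$ put $e_h(\boldsymbol\theta)=\mathbb E_{\boldsymbol\theta}\,h(\mathbf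 X)$ and $v_h(\boldsymbol\theta)=\mathbb V_{\boldsymbol\theta}\,h(\mathbf X)$ (the covariance matrix). An estimator is a *moment-type estimator* with functions $h$, $g$ if it equals $g(\overline{h(\mathbf X)})$ for every sample in $\mathbf S$, where $e_h$ is well defined and injective on $\boldsymbol\Theta$ and $g:\mathbb R^m\to\mathbb R^{k+1}$ satisfies $g|_{e_h(\boldsymbol\Theta)}=e_h^{-1}$; it *exists* when its value lies in $\boldsymbol\Theta$. **Theorem.** Let $\mathbf X_1,\mathbf X_2,\dots$ be i.i.d. with law $\mathcal{MG}_k(\boldsymbol\alpha,\beta)$ and $\mathbf Z_n=\Delta\mathbf X_n$. The Score-Adjusted Moment Estimator, computed from the first $n$ observations, $$\breve\beta=\frac1k\sum_{j=1}^k\left[\overline{Z_j\log Z_j}-\overline{Z_j}\,\overline{\log Z_j}\right],\qquad \breve\alpha_i=\frac{\overline{Z_i}}{\breve\beta},\quad i=1,\dots,k,$$ is a moment-type estimator of $(\boldsymbol\alpha,\beta)$ with functions (where $\mathbf z=\Delta\mathbf x$) $$h(\mathbf x)=(z_1,\dots,z_k,\log z_1,\dots,\log z_k,z_1\log z_1,\dots,z_k\log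 z_k),$$ $$g_i(\mathbf y)=\frac{y_i}{g_{k+1}(\mathbf y)}\ (1\le i\le k),\qquad g_{k+1}(\mathbf y)=\frac1k\sum_{j=1}^k(y_{2k+j}-y_jy_{k+j}).$$ Moreover $\mathbb E\|h(\mathbf X)\|^2<\infty$, $g$ is continuously differentiable at $\boldsymbol\mu=e_h(\boldsymbol\alpha,\beta)$, the estimator exists with probability tending to $1$, and, as $n\to\infty$, $$\sqrt n\left((\breve{\boldsymbol\alpha},\breve\beta)-(\boldsymbol\alpha,\beta)\right)\xrightarrow{\ \mathcal L\ }\mathcal N_{k+1}\left(\mathbf 0,\mathbf G\mathbf V\mathbf G^\top\right),$$ where $\mathbf V=v_h(\boldsymbol\alpha,\beta)$ is the $3k\times3k$ covariance matrix of $h(\mathbf X)$ and $\mathbf G$, the Jacobian matrix of $g$ at $\boldsymbol\mu$, is the $(k+1)\times3k$ block matrix $$\mathbf G=\begin{pmatrix}\mathbf G_{11}&\mathbf G_{12}&\mathbf G_{13}\\ \mathbf G_{21}&\mathbf G_{22}&\mathbf G_{23}\end{pmatrix}$$ with, for $1\le i,j\le k$, $$\mathbf G_{11,ij}=\frac{\alpha_i}{k\beta}\left[\psi(\alpha_j)+\log\beta\right]+\frac1\beta\mathbb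 I_{\{i=j\}},\qquad \mathbf G_{12,ij}=\frac{\alpha_i\alpha_j}{k},\qquad \mathbf G_{13,ij}=-\frac{\alpha_i}{k\beta},$$ $$\mathbf G_{21,j}=-\frac1k\left[\psi(\alpha_j)+\log\beta\right],\qquad \mathbf G_{22,j}=-\frac1k\alpha_j\beta,\qquad \mathbf G_{23,j}=\frac1k.$$ -/

import Mathlib

open MeasureTheory ProbabilityTheory Filter Topology

namespace MGamma

noncomputable section

/-! ### Moment-type estimators and asymptotic normality -/

/-- The average `(1/n) ∑ f(xᵢ)` of a statistic `f` over a sample `x₁, …, xₙ`. -/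
def sampleMean {𝒳 E : Type*} [AddCommGroup E] [Module ℝ E] {n : ℕ}
    (f : 𝒳 → E) (x : Fin n → 𝒳) : E :=
  (n : ℝ)⁻¹ • ∑ l, f (x l)

/-- `est` is a moment-type estimator of the parameter `θ ∈ Θ` of the family `D` of probability
distributions with support `S`, with functions `h` and `g`: the mean `e_h(θ)` of `h` under `D θ`
exists, `e_h` is injective on `Θ`, `g` restricted to `e_h(Θ)` is the inverse of `e_h`, and the
estimator of every sample from `S` is `g` of the average of `h`. -/
structure IsMomentTypeEstimator {𝒳 ι κ : Type*} [MeasurableSpace 𝒳] [Fintype ι] [Fintype κ]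
    (D : EuclideanSpace ℝ κ → Measure 𝒳) (S : Set 𝒳) (Θ : Set (EuclideanSpace ℝ κ))
    (h : 𝒳 → EuclideanSpace ℝ ι) (g : EuclideanSpace ℝ ι → EuclideanSpace ℝ κ)
    (est : (n : ℕ) → (Fin n → 𝒳) → EuclideanSpace ℝ κ) : Prop where
  isProbabilityMeasure : ∀ θ ∈ Θ, IsProbabilityMeasure (D θ)
  ae_mem_support : ∀ θ ∈ Θ, ∀ᵐ x ∂(D θ), x ∈ S
  integrable : ∀ θ ∈ Θ, Integrable h (D θ)
  injOn : Set.InjOn (fun θ => ∫ x, h x ∂(D θ)) Θ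
  leftInverse : ∀ θ ∈ Θ, g (∫ x, h x ∂(D θ)) = θ
  estimator_eq : ∀ (n : ℕ) (x : Fin n → 𝒳), (∀ l, x l ∈ S) → est n x = g (sampleMean h x)

/-- `√n (Tₙ - θ)` converges in law to the normal distribution `N(0, C)`. -/
def IsAsymptoticallyNormal {Ω κ : Type*} [MeasurableSpace Ω] [Fintype κ] [DecidableEq κ]
    (P : Measure Ω) [IsProbabilityMeasure P] (T : ℕ → Ω → EuclideanSpace ℝ κ)
    (θ : EuclideanSpace ℝ κ) (C : Matrix κ κ ℝ) : Prop :=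
  TendstoInDistribution (fun (n : ℕ) ω => √(n : ℝ) • (T n ω - θ)) atTop
    (id : EuclideanSpace ℝ κ → EuclideanSpace ℝ κ) (fun _ => P) (multivariateGaussian 0 C)

/-- The variance-covariance matrix `v_h` of the random vector `h(X)`, where `X` has law `μ`. -/
def covMat {𝒳 ι : Type*} [MeasurableSpace 𝒳] [Fintype ι]
    (μ : Measure 𝒳) (h : 𝒳 → EuclideanSpace ℝ ι) : Matrix ι ι ℝ :=
  Matrix.of fun a b => cov[fun x => h x a, fun x => h x b; μ]

/-- The digamma function of a real variable. -/
def digamma (a : ℝ) : ℝ := deriv (fun t => Real.log (Real.Gamma t)) a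

/-! ### The multivariate Gamma distribution -/

/-- The first difference operator `Δx = (x₁, x₂ - x₁, …, x_k - x_{k-1})`. -/
def diff {k : ℕ} (x : Fin k → ℝ) (i : Fin k) : ℝ :=
  if (i : ℕ) = 0 then x i else x i - x ⟨(i : ℕ) - 1, lt_of_le_of_lt (Nat.sub_le _ _) i.isLt⟩

/-- The last coordinate `x_k`. -/
def lastCoord {k : ℕ} [NeZero k] (x : Fin k → ℝ) : ℝ :=
  x ⟨k - 1, Nat.sub_one_lt (NeZero.ne k)⟩

/-- The support `{x ∈ (0, ∞)^k : x₁ < x₂ < … < x_k}`. -/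
def support (k : ℕ) : Set (Fin k → ℝ) := {x | (∀ i, 0 < x i) ∧ StrictMono x}

open Classical in
/-- The density of the multivariate Gamma distribution `MG_k(α, β)`. -/
def density {k : ℕ} [NeZero k] (α : Fin k → ℝ) (β : ℝ) (x : Fin k → ℝ) : ℝ :=
  if x ∈ support k then
    1 / (β ^ (∑ i, α i) * ∏ i, Real.Gamma (α i)) *
      (Real.exp (-lastCoord x / β) * ∏ i, diff x i ^ (α i - 1))
  else 0

/-- The multivariate Gamma distribution `MG_k(α, β)` of Mathai and Moschopoulos. -/
def mgamma {k : ℕ} [NeZero k] (α : Fin k → ℝ) (β : ℝ) : Measure (Fin k → ℝ) :=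
  (volume : Measure (Fin k → ℝ)).withDensity fun x => ENNReal.ofReal (density α β x)

/-- The parameter vector `(α, β) ∈ ℝ^{k+1}`. -/
def param {k : ℕ} (α : Fin k → ℝ) (β : ℝ) : EuclideanSpace ℝ (Fin k ⊕ Unit) :=
  WithLp.toLp 2 (Sum.elim α fun _ => β)

/-- The parameter space `(0, ∞)^k × (0, ∞)`. -/
def paramSpace (k : ℕ) : Set (EuclideanSpace ℝ (Fin k ⊕ Unit)) := {θ | ∀ i, 0 < θ i}

/-- The family of distributions `θ = (α, β) ↦ MG_k(α, β)`. -/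
def family (k : ℕ) [NeZero k] (θ : EuclideanSpace ℝ (Fin k ⊕ Unit)) : Measure (Fin k → ℝ) :=
  mgamma (fun i => θ (Sum.inl i)) (θ (Sum.inr ()))

/-! ### The score-adjusted moment estimator -/

/-- `(1/k) ∑ⱼ [mean(Zⱼ log Zⱼ) - mean(Zⱼ) mean(log Zⱼ)]` for the sample `Z = Δx`. -/
def betaSAME {k n : ℕ} (x : Fin n → Fin k → ℝ) : ℝ :=
  1 / (k : ℝ) * ∑ j, (sampleMean (fun y => diff y j * Real.log (diff y j)) x -
    sampleMean (fun y => diff y j) x * sampleMean (fun y => Real.log (diff y j)) x)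

/-- `mean(Zᵢ)` divided by the estimator of `β`. -/
def alphaSAME {k n : ℕ} (x : Fin n → Fin k → ℝ) (i : Fin k) : ℝ :=
  sampleMean (fun y => diff y i) x / betaSAME x

/-- The score-adjusted moment estimator of `(α, β)`. -/
def same (k n : ℕ) (x : Fin n → Fin k → ℝ) : EuclideanSpace ℝ (Fin k ⊕ Unit) :=
  param (alphaSAME x) (betaSAME x)

/-- `h(x) = (z₁, …, z_k, log z₁, …, log z_k, z₁ log z₁, …, z_k log z_k)` with `z = Δx`. -/
def hFun (k : ℕ) (x : Fin k → ℝ) : EuclideanSpace ℝ (Fin k ⊕ (Fin k ⊕ Fin k)) :=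
  WithLp.toLp 2 (Sum.elim (fun j => diff x j)
    (Sum.elim (fun j => Real.log (diff x j)) fun j => diff x j * Real.log (diff x j)))

/-- The last component `g_{k+1}(y) = (1/k) ∑ⱼ (y_{2k+j} - yⱼ y_{k+j})` of `g`. -/
def gLast {k : ℕ} (y : EuclideanSpace ℝ (Fin k ⊕ (Fin k ⊕ Fin k))) : ℝ :=
  1 / (k : ℝ) * ∑ j : Fin k,
    (y (Sum.inr (Sum.inr j)) - y (Sum.inl j) * y (Sum.inr (Sum.inl j)))

/-- `g(y) = (y₁ / g_{k+1}(y), …, y_k / g_{k+1}(y), g_{k+1}(y))`. -/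
def gFun (k : ℕ) (y : EuclideanSpace ℝ (Fin k ⊕ (Fin k ⊕ Fin k))) :
    EuclideanSpace ℝ (Fin k ⊕ Unit) :=
  param (fun i => y (Sum.inl i) / gLast y) (gLast y)

/-- The `(k+1) × 3k` block matrix `G`. -/
def GMat {k : ℕ} (α : Fin k → ℝ) (β : ℝ) :
    Matrix (Fin k ⊕ Unit) (Fin k ⊕ (Fin k ⊕ Fin k)) ℝ :=
  Matrix.fromBlocks
    (Matrix.of fun i j =>
      α i / (k * β) * (digamma (α j) + Real.log β) + if i = j then 1 / β else 0)
    (Matrix.fromCols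
      (Matrix.of fun i j => α i * α j / k)
      (Matrix.of fun i _ => -(α i / (k * β))))
    (Matrix.of fun _ j => -(1 / (k : ℝ)) * (digamma (α j) + Real.log β))
    (Matrix.fromCols
      (Matrix.of fun _ j => -(1 / (k : ℝ)) * (α j * β))
      (Matrix.of fun _ _ => 1 / (k : ℝ)))

end

end MGamma

open MGamma

namespace MGamma

/-! ### Law of the increments -/

/-! The map `diff` is linear and unitriangular, so it preserves volume, and the increments add up to
the last coordinate, so the density splits into Gamma densities. Hence the increments `Z i` are
independent Gamma variables of shape `α i` and scale `β` (`measurePreserving_diff_mgamma`), and the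
moments of `h` are one-dimensional.

For a Gamma variable `Z` of shape `a`, the moment generating function of `log Z` is the Mellin
transform `β ^ t * Γ(a + t) / Γ(a)`, finite for `t > -a`. Its derivatives at 0 and 1 give `E log Z =
ψ(a) + log β` and `E[Z log Z] = aβ(ψ(a) + log β) + β`. So `Cov(Z, log Z) = β` whatever the shape:
averaging these covariances recovers `β`, dividing the means by it recovers `α`, and `g` inverts the
mean map (`gFun_meanVec`).

The estimator is `g` of the sample mean of `h`. Square integrability of `h` gives the strong law and
a multivariate central limit theorem (Cramér–Wold), and the delta method transfers them through `g`,
whose derivative at the mean is `GMat` (`hasFDerivAt_gFun`). -/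

lemma pi_withDensity_ofReal {ι : Type*} [Fintype ι] {𝒳 : ι → Type*} [∀ i, MeasurableSpace (𝒳 i)]
    (μ : ∀ i, Measure (𝒳 i)) [∀ i, SigmaFinite (μ i)] {p : ∀ i, 𝒳 i → ℝ}
    (hp : ∀ i x, 0 ≤ p i x) (hi : ∀ i, Integrable (p i) (μ i)) :
    (Measure.pi μ).withDensity (fun x => ENNReal.ofReal (∏ i, p i (x i))) =
      Measure.pi fun i => (μ i).withDensity fun x => ENNReal.ofReal (p i x) := by
  have : ∀ i, IsFiniteMeasure ((μ i).withDensity fun x => ENNReal.ofReal (p i x)) := fun i =>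
    isFiniteMeasure_withDensity_ofReal (hi i).2
  symm
  refine Measure.pi_eq fun s hs => ?_
  have hind : ∀ i, Integrable ((s i).indicator (p i)) (μ i) := fun i => (hi i).indicator (hs i)
  have hnn : ∀ i x, 0 ≤ (s i).indicator (p i) x := fun i x =>
    Set.indicator_nonneg (fun y _ => hp i y) x
  rw [withDensity_apply _ (MeasurableSet.univ_pi hs), ← lintegral_indicator (MeasurableSet.univ_pi hs)]
  have hpt : ∀ x : (∀ i, 𝒳 i), (Set.univ.pi s).indicator
      (fun x => ENNReal.ofReal (∏ i, p i (x i))) x =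
      ENNReal.ofReal (∏ i, (s i).indicator (p i) (x i)) := by
    intro x
    by_cases hx : x ∈ Set.univ.pi s
    · rw [Set.indicator_of_mem hx]
      congr 1
      exact Finset.prod_congr rfl fun i _ =>
        (Set.indicator_of_mem (hx i (Set.mem_univ i)) _).symm
    · rw [Set.indicator_of_notMem hx]
      obtain ⟨i, hi⟩ : ∃ i, x i ∉ s i := by simpa using hx
      rw [Finset.prod_eq_zero (Finset.mem_univ i) (Set.indicator_of_notMem hi _),
        ENNReal.ofReal_zero]
  simp_rw [hpt]
  rw [← ofReal_integral_eq_lintegral_ofReal (Integrable.fintype_prod_dep hind)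
    (ae_of_all _ fun x => Finset.prod_nonneg fun i _ => hnn i _),
    integral_fintype_prod_eq_prod, ENNReal.ofReal_prod_of_nonneg
      fun i _ => integral_nonneg (hnn i)]
  refine Finset.prod_congr rfl fun i _ => ?_
  rw [withDensity_apply _ (hs i), integral_indicator (hs i),
    ofReal_integral_eq_lintegral_ofReal (hi i).integrableOn (ae_of_all _ (hp i))]

/-- `gammaPDFReal` is supported on the closed half-line, the density of `MG_k` on strict
inequalities; the two differ only on a null set. -/
lemma withDensity_indicator_gammaPDFReal (a r : ℝ) :
    (volume : Measure ℝ).withDensity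
      (fun z => ENNReal.ofReal ((Set.Ioi 0).indicator (gammaPDFReal a r) z)) =
      gammaMeasure a r := by
  refine withDensity_congr_ae ?_
  filter_upwards [Measure.ae_ne volume (0 : ℝ)] with z hz
  rw [gammaPDF]
  congr 1
  rcases lt_or_gt_of_ne hz with h | h
  · rw [Set.indicator_of_notMem (by simpa using h.le), gammaPDFReal, if_neg (not_le.2 h)]
  · rw [Set.indicator_of_mem (by simpa using h)]

lemma integrable_gammaPDFReal {a r : ℝ} (ha : 0 < a) (hr : 0 < r) :
    Integrable (gammaPDFReal a r) := by
  refine ⟨by fun_prop, ?_⟩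
  rw [hasFiniteIntegral_iff_ofReal (ae_of_all _ (gammaPDFReal_nonneg ha hr))]
  have := lintegral_gammaPDF_eq_one ha hr
  unfold gammaPDF at this
  rw [this]
  exact ENNReal.one_lt_top

lemma diff_zero {k : ℕ} (x : Fin (k + 1) → ℝ) : diff x 0 = x 0 := by simp [diff]

lemma diff_succ {k : ℕ} (x : Fin (k + 1) → ℝ) (i : Fin k) :
    diff x i.succ = x i.succ - x i.castSucc := by
  simp [diff]; rfl

lemma sum_diff {k : ℕ} [NeZero k] (x : Fin k → ℝ) : ∑ i, diff x i = lastCoord x := by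
  obtain ⟨k, rfl⟩ := Nat.exists_eq_succ_of_ne_zero (NeZero.ne k)
  rw [Fin.sum_univ_succ, diff_zero]
  simp_rw [diff_succ]
  have h1 := Fin.sum_univ_succ x
  have h2 := Fin.sum_univ_castSucc x
  have h3 : lastCoord x = x (Fin.last k) := rfl
  rw [Finset.sum_sub_distrib, h3]
  linarith

lemma mem_support_iff {k : ℕ} (x : Fin k → ℝ) : x ∈ support k ↔ ∀ i, 0 < diff x i := by
  cases k with
  | zero => exact ⟨fun _ i => i.elim0, fun _ => ⟨fun i => i.elim0, fun i => i.elim0⟩⟩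
  | succ k =>
    constructor
    · rintro ⟨h0, hm⟩ i
      refine Fin.cases ?_ (fun i => ?_) i
      · rw [diff_zero]; exact h0 0
      · rw [diff_succ]; exact sub_pos.2 (hm (Fin.castSucc_lt_succ))
    · intro h
      have hm : StrictMono x := Fin.strictMono_iff_lt_succ.2 fun i => by
        have := h i.succ
        rw [diff_succ] at this
        exact sub_pos.1 this
      refine ⟨fun i => ?_, hm⟩
      have := h 0
      rw [diff_zero] at this
      exact this.trans_le (hm.monotone (Fin.zero_le i))

/-- On the support the exponentials combine because the increments telescope to `lastCoord`; off the
support some increment is nonpositive and its indicator kills the product. -/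
lemma density_eq_prod {k : ℕ} [NeZero k] {α : Fin k → ℝ} {β : ℝ} (hβ : 0 < β) (x : Fin k → ℝ) :
    density α β x = ∏ i, (Set.Ioi 0).indicator (gammaPDFReal (α i) β⁻¹) (diff x i) := by
  rw [density]
  split_ifs with hx
  · rw [mem_support_iff] at hx
    have : ∀ i, (Set.Ioi 0).indicator (gammaPDFReal (α i) β⁻¹) (diff x i) =
        (β ^ α i)⁻¹ * (Real.Gamma (α i))⁻¹ *
          (Real.exp (-(β⁻¹ * diff x i)) * diff x i ^ (α i - 1)) := by
      intro i
      rw [Set.indicator_of_mem (Set.mem_Ioi.2 (hx i)), gammaPDFReal, if_pos (hx i).le, Real.inv_rpow hβ.le]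
      ring
    simp_rw [this]
    rw [Finset.prod_mul_distrib, Finset.prod_mul_distrib, Finset.prod_mul_distrib,
      ← Real.exp_sum, Finset.prod_inv_distrib, Finset.prod_inv_distrib,
      Finset.sum_neg_distrib, ← Finset.mul_sum, sum_diff, ← Real.rpow_sum_of_pos hβ]
    rw [one_div, mul_inv, neg_div, div_eq_inv_mul]
  · rw [mem_support_iff] at hx
    push Not at hx
    obtain ⟨i, hi⟩ := hx
    exact (Finset.prod_eq_zero (Finset.mem_univ i)
      (Set.indicator_of_notMem (fun h => absurd (Set.mem_Ioi.1 h) (not_lt.2 hi)) _)).symm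

/-- The first difference operator as a linear map. -/
noncomputable def diffLin (k : ℕ) : (Fin k → ℝ) →ₗ[ℝ] (Fin k → ℝ) where
  toFun := diff
  map_add' x y := by ext i; simp only [diff, Pi.add_apply]; split_ifs <;> ring
  map_smul' c x := by
    ext i; simp only [diff, Pi.smul_apply, smul_eq_mul, RingHom.id_apply]; split_ifs <;> ring

lemma det_diffLin (k : ℕ) : LinearMap.det (diffLin k) = 1 := by
  rw [← LinearMap.det_toMatrix', Matrix.det_of_isLowerTriangular]
  · refine Finset.prod_eq_one fun i _ => ?_
    rw [LinearMap.toMatrix'_apply]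
    change diff _ i = 1
    unfold diff
    split_ifs with h
    · simp
    -- Truncated subtraction is harmless here: this branch has `i ≠ 0`, so the predecessor is a
    -- different index.
    · have : (⟨(i : ℕ) - 1, lt_of_le_of_lt (Nat.sub_le _ _) i.isLt⟩ : Fin k) ≠ i := by
        intro h'; have := congrArg Fin.val h'; simp at this; omega
      simp [this]
  · intro i j hij
    have hij : i < j := hij
    rw [LinearMap.toMatrix'_apply]
    change diff _ i = 0
    unfold diff
    have h2 : (⟨(i : ℕ) - 1, lt_of_le_of_lt (Nat.sub_le _ _) i.isLt⟩ : Fin k) ≠ j := by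
      intro h'; have := congrArg Fin.val h'; have : (i : ℕ) < j := hij; simp at *; omega
    split_ifs with h <;> simp [hij.ne, h2]

lemma measurable_diff (k : ℕ) : Measurable (diff : (Fin k → ℝ) → Fin k → ℝ) :=
  (diffLin k).continuous_of_finiteDimensional.measurable

lemma measurePreserving_diff (k : ℕ) :
    MeasurePreserving (diff : (Fin k → ℝ) → Fin k → ℝ) volume volume := by
  refine ⟨measurable_diff k, ?_⟩
  have h := Real.map_linearMap_volume_pi_eq_smul_volume_pi (f := diffLin k)
    (by rw [det_diffLin]; exact one_ne_zero)
  rw [det_diffLin] at h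
  have h' : Measure.map (diffLin k) volume = volume := by simpa using h
  exact h'

lemma measurableSet_support (k : ℕ) : MeasurableSet (support k) := by
  have : support k = ⋂ i, {x | 0 < diff x i} := by
    ext x; simp [mem_support_iff]
  rw [this]
  exact MeasurableSet.iInter fun i =>
    measurableSet_lt measurable_const ((measurable_pi_apply i).comp (measurable_diff k))

section Law

variable {k : ℕ} [NeZero k] {α : Fin k → ℝ} {β : ℝ}

theorem measurePreserving_diff_mgamma (hα : ∀ i, 0 < α i) (hβ : 0 < β) :
    MeasurePreserving diff (mgamma α β) (Measure.pi fun i => gammaMeasure (α i) β⁻¹) := by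
  refine ⟨measurable_diff k, ?_⟩
  have hr : 0 < β⁻¹ := inv_pos.2 hβ
  have hpi := pi_withDensity_ofReal (fun _ : Fin k => (volume : Measure ℝ))
    (p := fun i => (Set.Ioi 0).indicator (gammaPDFReal (α i) β⁻¹))
    (fun i x => Set.indicator_nonneg (fun y _ => gammaPDFReal_nonneg (hα i) hr y) x)
    (fun i => (integrable_gammaPDFReal (hα i) hr).indicator measurableSet_Ioi)
  simp_rw [withDensity_indicator_gammaPDFReal] at hpi
  rw [← hpi]
  ext s hs
  rw [Measure.map_apply (measurable_diff k) hs, mgamma,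
    withDensity_apply _ (measurable_diff k hs), withDensity_apply _ hs]
  simp_rw [density_eq_prod hβ]
  refine (measurePreserving_diff k).setLIntegral_comp_preimage hs
    (f := fun z => ENNReal.ofReal
      (∏ i, (Set.Ioi 0).indicator (gammaPDFReal (α i) β⁻¹) (z i))) ?_
  refine (Finset.measurable_prod _ fun i _ => ?_).ennreal_ofReal
  exact ((measurable_gammaPDFReal _ _).indicator measurableSet_Ioi).comp (measurable_pi_apply i)

theorem isProbabilityMeasure_mgamma (hα : ∀ i, 0 < α i) (hβ : 0 < β) :
    IsProbabilityMeasure (mgamma α β) := by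
  have := fun i => isProbabilityMeasure_gammaMeasure (hα i) (inv_pos.2 hβ)
  exact (measurePreserving_diff_mgamma hα hβ).hasLaw.isProbabilityMeasure_iff.2 inferInstance

theorem measurePreserving_diff_apply (hα : ∀ i, 0 < α i) (hβ : 0 < β) (i : Fin k) :
    MeasurePreserving (fun x => diff x i) (mgamma α β) (gammaMeasure (α i) β⁻¹) := by
  have := fun i => isProbabilityMeasure_gammaMeasure (hα i) (inv_pos.2 hβ)
  exact (measurePreserving_eval (fun i => gammaMeasure (α i) β⁻¹) i).comp
    (measurePreserving_diff_mgamma hα hβ)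

theorem ae_mem_support_mgamma (α : Fin k → ℝ) (β : ℝ) : ∀ᵐ x ∂(mgamma α β), x ∈ support k := by
  rw [ae_iff, mgamma]
  change (volume.withDensity _) (support k)ᶜ = 0
  rw [withDensity_apply _ (measurableSet_support k).compl,
    setLIntegral_congr_fun (g := fun _ => 0) (measurableSet_support k).compl, lintegral_zero]
  intro x hx
  have hx : x ∉ support k := hx
  simp [density, hx]

end Law

/-! ### Moments of the Gamma distribution -/

lemma digamma_add_one {a : ℝ} (ha : 0 < a) : digamma (a + 1) = digamma a + a⁻¹ := by
  have hd : DifferentiableAt ℝ (fun t => Real.log (Real.Gamma t)) a :=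
    (Real.differentiableAt_Gamma fun m =>
      ((neg_nonpos.2 m.cast_nonneg).trans_lt ha).ne').log (Real.Gamma_pos_of_pos ha).ne'
  have h1 : (fun t => Real.log (Real.Gamma (t + 1))) =ᶠ[𝓝 a]
      fun t => Real.log (Real.Gamma t) + Real.log t := by
    filter_upwards [lt_mem_nhds ha] with t ht
    rw [Real.Gamma_add_one ht.ne', Real.log_mul ht.ne' (Real.Gamma_pos_of_pos ht).ne', add_comm]
  rw [digamma, ← deriv_comp_add_const, h1.deriv_eq]
  exact (hd.hasDerivAt.add (Real.hasDerivAt_log ha.ne')).deriv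

lemma hasDerivAt_Gamma {a : ℝ} (ha : 0 < a) :
    HasDerivAt Real.Gamma (Real.Gamma a * digamma a) a := by
  have hG := (Real.Gamma_pos_of_pos ha).ne'
  have hd : DifferentiableAt ℝ Real.Gamma a := Real.differentiableAt_Gamma fun m =>
      ((neg_nonpos.2 m.cast_nonneg).trans_lt ha).ne'
  have : digamma a = deriv Real.Gamma a / Real.Gamma a := deriv.log hd hG
  rw [this, mul_div_cancel₀ _ hG]
  exact hd.hasDerivAt

section GammaMeasure

variable {a r : ℝ}

lemma measurable_gammaPDF (a r : ℝ) : Measurable (gammaPDF a r) :=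
  (measurable_gammaPDFReal a r).ennreal_ofReal

lemma ae_pos_gammaMeasure : ∀ᵐ z ∂(gammaMeasure a r), 0 < z := by
  rw [gammaMeasure, ae_withDensity_iff (measurable_gammaPDF a r)]
  filter_upwards [Measure.ae_ne volume (0 : ℝ)] with z hz h
  by_contra hz'
  exact h (gammaPDF_of_neg (lt_of_le_of_ne (not_lt.1 hz') hz))

lemma integral_gammaMeasure (ha : 0 < a) (hr : 0 < r) (f : ℝ → ℝ) :
    ∫ z, f z ∂(gammaMeasure a r) =
      ∫ z in Set.Ioi 0, r ^ a / Real.Gamma a * z ^ (a - 1) * Real.exp (-(r * z)) * f z := by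
  rw [gammaMeasure, integral_withDensity_eq_integral_toReal_smul
    (measurable_gammaPDF a r) (ae_of_all _ fun _ => ENNReal.ofReal_lt_top)]
  have : ∀ z, (gammaPDF a r z).toReal • f z = (Set.Ici 0).indicator
      (fun z => r ^ a / Real.Gamma a * z ^ (a - 1) * Real.exp (-(r * z)) * f z) z := by
    intro z
    rw [gammaPDF, ENNReal.toReal_ofReal (gammaPDFReal_nonneg ha hr z), gammaPDFReal]
    by_cases hz : 0 ≤ z
    · simp [hz]
    · simp [hz]
  simp_rw [this]
  rw [integral_indicator measurableSet_Ici, integral_Ici_eq_integral_Ioi]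

/-- The Mellin transform of the Gamma distribution. -/
lemma mgf_log_gammaMeasure (ha : 0 < a) (hr : 0 < r) {t : ℝ} (ht : -a < t) :
    mgf Real.log (gammaMeasure a r) t = r⁻¹ ^ t * (Real.Gamma (a + t) / Real.Gamma a) := by
  have hat : 0 < a + t := by linarith
  rw [mgf, integral_gammaMeasure ha hr]
  have : ∫ z in Set.Ioi (0 : ℝ), r ^ a / Real.Gamma a * z ^ (a - 1) * Real.exp (-(r * z)) *
      Real.exp (t * Real.log z) = ∫ z in Set.Ioi (0 : ℝ),
        r ^ a / Real.Gamma a * (z ^ (a + t - 1) * Real.exp (-(r * z))) := by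
    refine setIntegral_congr_fun measurableSet_Ioi fun z hz => ?_
    have hz : 0 < z := hz
    have h1 : Real.exp (t * Real.log z) = z ^ t := by rw [Real.rpow_def_of_pos hz, mul_comm]
    have h2 : z ^ (a + t - 1) = z ^ (a - 1) * z ^ t := by
      rw [← Real.rpow_add hz]; ring_nf
    simp only [h1, h2]
    ring
  rw [this, integral_const_mul, Real.integral_rpow_mul_exp_neg_mul_Ioi hat hr, one_div,
    Real.inv_rpow hr.le, Real.inv_rpow hr.le, Real.rpow_add hr]
  have := (Real.rpow_pos_of_pos hr a).ne'
  have := (Real.rpow_pos_of_pos hr t).ne'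
  have := (Real.Gamma_pos_of_pos ha).ne'
  field_simp

/-- Integrability is read off from the closed form: a divergent integral would have the default
value 0, whereas the Mellin transform is positive. -/
lemma mem_interior_integrableExpSet_log (ha : 0 < a) (hr : 0 < r) {t : ℝ} (ht : -a < t) :
    t ∈ interior (integrableExpSet Real.log (gammaMeasure a r)) := by
  rw [mem_interior_iff_mem_nhds]
  filter_upwards [lt_mem_nhds ht] with s hs
  have h := mgf_log_gammaMeasure ha hr hs
  by_contra hni
  have h0 : mgf Real.log (gammaMeasure a r) s = 0 := integral_undef hni
  rw [h0] at h
  have := Real.Gamma_pos_of_pos ha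
  have := Real.Gamma_pos_of_pos (show 0 < a + s by linarith)
  have : 0 < r⁻¹ ^ s * (Real.Gamma (a + s) / Real.Gamma a) := by positivity
  exact this.ne h

/-- The Mellin transform is differentiated twice over, once under the integral sign and once in
closed form, and the results are compared. -/
lemma integral_log_mul_exp_gammaMeasure (ha : 0 < a) (hr : 0 < r) {t : ℝ} (ht : -a < t) :
    ∫ z, Real.log z * Real.exp (t * Real.log z) ∂(gammaMeasure a r) =
      r⁻¹ ^ t * (Real.Gamma (a + t) / Real.Gamma a) * (digamma (a + t) + Real.log r⁻¹) := by
  have hat : 0 < a + t := by linarith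
  have hr' : 0 < r⁻¹ := inv_pos.2 hr
  have h1 := hasDerivAt_mgf (mem_interior_integrableExpSet_log ha hr ht)
  have h2 : mgf Real.log (gammaMeasure a r) =ᶠ[𝓝 t]
      fun s => r⁻¹ ^ s * (Real.Gamma (a + s) / Real.Gamma a) := by
    filter_upwards [lt_mem_nhds ht] with s hs using mgf_log_gammaMeasure ha hr hs
  have h3 := (Real.hasStrictDerivAt_const_rpow hr' t).hasDerivAt.mul
    (((hasDerivAt_Gamma hat).comp_const_add a t).div_const (Real.Gamma a))
  rw [h1.unique (h3.congr_of_eventuallyEq h2)]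
  ring

lemma exp_log_ae (s : ℝ) :
    ∀ᵐ z ∂(gammaMeasure a r), Real.exp (s * Real.log z) = z ^ s := by
  filter_upwards [ae_pos_gammaMeasure] with z hz
  rw [Real.rpow_def_of_pos hz, mul_comm]

theorem integral_id_gammaMeasure (ha : 0 < a) (hr : 0 < r) :
    ∫ z, z ∂(gammaMeasure a r) = a * r⁻¹ := by
  have h := mgf_log_gammaMeasure ha hr (t := 1) (by linarith)
  rw [mgf, integral_congr_ae (exp_log_ae 1)] at h
  simp only [Real.rpow_one] at h
  rw [h, Real.Gamma_add_one ha.ne', mul_div_cancel_right₀ _ (Real.Gamma_pos_of_pos ha).ne',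
    mul_comm]

theorem integral_log_gammaMeasure (ha : 0 < a) (hr : 0 < r) :
    ∫ z, Real.log z ∂(gammaMeasure a r) = digamma a + Real.log r⁻¹ := by
  have h := integral_log_mul_exp_gammaMeasure ha hr (t := 0) (by linarith)
  simpa [div_self (Real.Gamma_pos_of_pos ha).ne'] using h

/-- At `t = 1` the shift `ψ(a + 1) = ψ(a) + 1 / a` produces the extra summand `r⁻¹`, which is the
covariance of `z` and `log z` and does not depend on `a`. -/
theorem integral_mul_log_gammaMeasure (ha : 0 < a) (hr : 0 < r) :
    ∫ z, z * Real.log z ∂(gammaMeasure a r) =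
      a * r⁻¹ * (digamma a + Real.log r⁻¹) + r⁻¹ := by
  have h := integral_log_mul_exp_gammaMeasure ha hr (t := 1) (by linarith)
  have hc : (fun z => Real.log z * Real.exp (1 * Real.log z)) =ᵐ[gammaMeasure a r]
      fun z => z * Real.log z := by
    filter_upwards [exp_log_ae 1] with z hz
    rw [hz, Real.rpow_one, mul_comm]
  rw [integral_congr_ae hc] at h
  rw [h, Real.Gamma_add_one ha.ne', mul_div_cancel_right₀ _ (Real.Gamma_pos_of_pos ha).ne',
    digamma_add_one ha, Real.rpow_one]
  field_simp
  ring

theorem memLp_log_gammaMeasure (ha : 0 < a) (hr : 0 < r) :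
    MemLp Real.log 2 (gammaMeasure a r) := by
  exact_mod_cast memLp_of_mem_interior_integrableExpSet
    (mem_interior_integrableExpSet_log ha hr (by linarith)) 2

theorem memLp_id_gammaMeasure (ha : 0 < a) (hr : 0 < r) :
    MemLp (fun z => z) 2 (gammaMeasure a r) := by
  rw [memLp_two_iff_integrable_sq (by fun_prop)]
  -- The square of `z` is `exp (2 * log z)`, and `t = 2` lies in the interior of the integrability
  -- set.
  have h := integrable_pow_mul_exp_of_mem_interior_integrableExpSet
    (mem_interior_integrableExpSet_log ha hr (t := 2) (by linarith)) 0
  refine h.congr ?_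
  filter_upwards [exp_log_ae 2] with z hz
  simp [hz]

theorem memLp_mul_log_gammaMeasure (ha : 0 < a) (hr : 0 < r) :
    MemLp (fun z => z * Real.log z) 2 (gammaMeasure a r) := by
  rw [memLp_two_iff_integrable_sq (by fun_prop)]
  have h := integrable_pow_mul_exp_of_mem_interior_integrableExpSet
    (mem_interior_integrableExpSet_log ha hr (t := 2) (by linarith)) 2
  refine h.congr ?_
  filter_upwards [exp_log_ae 2] with z hz
  rw [hz, Real.rpow_two, mul_pow, mul_comm]

end GammaMeasure

open scoped RealInnerProductSpace Matrix

/-! ### The multivariate central limit theorem and the delta method -/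

section CLT

variable {Ω ι : Type*} [MeasurableSpace Ω] [Fintype ι] {P : Measure Ω} [IsProbabilityMeasure P]

lemma variance_inner_eq_dotProduct_covMat {Y : Ω → EuclideanSpace ℝ ι} (hY : MemLp Y 2 P)
    (t : EuclideanSpace ℝ ι) :
    Var[fun ω => ⟪Y ω, t⟫; P] = t.ofLp ⬝ᵥ covMat P Y *ᵥ t.ofLp := by
  have hc : ∀ i, MemLp (fun ω => t i * Y ω i) 2 P := fun i => (hY.eval_piLp i).const_mul _
  have h : (fun ω => ⟪Y ω, t⟫) = fun ω => ∑ i, t i * Y ω i := by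
    ext ω; simp [PiLp.inner_apply]
  rw [h, ← covariance_self (memLp_finsetSum _ fun i _ => hc i).aemeasurable,
    covariance_fun_sum_fun_sum hc hc]
  simp_rw [covariance_const_mul_left, covariance_const_mul_right, dotProduct, Matrix.mulVec,
    dotProduct, Finset.mul_sum]
  refine Finset.sum_congr rfl fun i _ => Finset.sum_congr rfl fun j _ => ?_
  simp only [covMat, Matrix.of_apply]
  ring

lemma posSemidef_covMat {Y : Ω → EuclideanSpace ℝ ι} (hY : MemLp Y 2 P) :
    (covMat P Y).PosSemidef := by
  refine Matrix.PosSemidef.of_dotProduct_mulVec_nonneg ?_ fun x => ?_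
  · ext i j
    simp only [covMat, Matrix.conjTranspose_apply, Matrix.of_apply, star_trivial]
    exact covariance_comm _ _
  · have h := variance_inner_eq_dotProduct_covMat hY (WithLp.toLp 2 x)
    rw [star_trivial]
    exact (variance_nonneg _ _).trans_eq h

-- The Cramér–Wold reduction: the frequency `t` is absorbed into a scalar projection evaluated at
-- frequency 1.
omit [IsProbabilityMeasure P] in
lemma charFun_map_eq_charFun_map_inner {Y : Ω → EuclideanSpace ℝ ι} (hY : AEMeasurable Y P)
    (t : EuclideanSpace ℝ ι) :
    charFun (P.map Y) t = charFun (P.map fun ω => ⟪Y ω, t⟫) 1 := by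
  rw [charFun_apply, charFun_apply_real, integral_map hY (by fun_prop),
    integral_map (by fun_prop) (by fun_prop)]
  simp

variable [DecidableEq ι]

theorem tendstoInDistribution_inv_sqrt_smul_sum_sub {Y : ℕ → Ω → EuclideanSpace ℝ ι}
    (hY : MemLp (Y 0) 2 P) (hindep : iIndepFun Y P)
    (hident : ∀ i, IdentDistrib (Y i) (Y 0) P P) :
    TendstoInDistribution
      (fun (n : ℕ) ω => (√(n : ℝ))⁻¹ • (∑ l ∈ Finset.range n, Y l ω - (n : ℝ) • P[Y 0])) atTop
      (id : EuclideanSpace ℝ ι → EuclideanSpace ℝ ι) (fun _ => P)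
      (multivariateGaussian 0 (covMat P (Y 0))) := by
  have hm : ∀ i, AEMeasurable (Y i) P := fun i => (hident i).aemeasurable_fst
  have hmeas : ∀ n : ℕ, AEMeasurable
      (fun ω => (√(n : ℝ))⁻¹ • (∑ l ∈ Finset.range n, Y l ω - (n : ℝ) • P[Y 0])) P := fun n =>
    ((Finset.aemeasurable_fun_sum _ fun i _ => hm i).sub_const _).fun_const_smul _
  refine ⟨hmeas, aemeasurable_id, ProbabilityMeasure.tendsto_iff_tendsto_charFun.2 fun t => ?_⟩
  have hmap : (fun ω => ⟪Y 0 ω, t⟫) = fun ω => ⟪t, Y 0 ω⟫ := by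
    ext ω; exact real_inner_comm _ _
  have hint : P[fun ω => ⟪Y 0 ω, t⟫] = ⟪P[Y 0], t⟫ := by
    rw [hmap, integral_inner (hY.integrable (by norm_num)), real_inner_comm]
  -- The scalar central limit theorem for the projection on `t`; its limit variance is the quadratic
  -- form of the covariance matrix at `t`.
  have h1 := tendstoInDistribution_inv_sqrt_mul_sum_sub (P := P)
    (X := fun i ω => ⟪Y i ω, t⟫) (Y := id)
    (P' := gaussianReal 0 Var[fun ω => ⟪Y 0 ω, t⟫; P].toNNReal)
    HasLaw.id (by rw [hmap]; exact hY.const_inner t)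
    (hindep.comp (fun _ x => ⟪x, t⟫) (by fun_prop))
    (fun i => (hident i).comp (u := fun x => ⟪x, t⟫) (by fun_prop))
  have h2 := ProbabilityMeasure.tendsto_iff_tendsto_charFun.1 h1.tendsto 1
  simp only [ProbabilityMeasure.coe_mk, Measure.map_id] at h2 ⊢
  rw [charFun_multivariateGaussian (posSemidef_covMat hY),
    ← variance_inner_eq_dotProduct_covMat hY]
  rw [charFun_gaussianReal] at h2
  convert h2 using 2 with n
  · rw [charFun_map_eq_charFun_map_inner (hmeas n)]
    congr 2
    ext ω
    rw [real_inner_smul_left, inner_sub_left, sum_inner, real_inner_smul_left, hint]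
  · simp [Real.coe_toNNReal _ (variance_nonneg _ _)]

end CLT

section Delta

variable {Ω Ω' E F : Type*} [MeasurableSpace Ω] [MeasurableSpace Ω']
  {P : Measure Ω} [IsProbabilityMeasure P] {P' : Measure Ω'} [IsProbabilityMeasure P']
  [NormedAddCommGroup E] [NormedSpace ℝ E] [MeasurableSpace E] [BorelSpace E]
  [SecondCountableTopology E]
  [NormedAddCommGroup F] [NormedSpace ℝ F] [MeasurableSpace F] [BorelSpace F]
  [SecondCountableTopology F]

/-- The delta method. -/
theorem tendstoInDistribution_of_hasFDerivAt {g : E → F} {L : E →L[ℝ] F} {μ : E}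
    (hg : HasFDerivAt g L μ) (hgm : Measurable g) {T : ℕ → Ω → E} {Z : Ω' → E} {c : ℕ → ℝ}
    (hTm : ∀ n, AEMeasurable (T n) P) (hT : ∀ᵐ ω ∂P, Tendsto (fun n => T n ω) atTop (𝓝 μ))
    (hc : ∀ n, 0 ≤ c n)
    (hTd : TendstoInDistribution (fun n ω => c n • (T n ω - μ)) atTop Z (fun _ => P) P') :
    TendstoInDistribution (fun n ω => c n • (g (T n ω) - g μ)) atTop (fun ω => L (Z ω))
      (fun _ => P) P' := by
  -- The normalized Taylor remainder. It vanishes at `μ` itself, since `0⁻¹ = 0`, so it is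
  -- continuous there.
  set R : E → F := fun y => ‖y - μ‖⁻¹ • (g y - g μ - L (y - μ)) with hR
  have hRm : Measurable R := by
    have : Measurable fun y => L (y - μ) := by fun_prop
    have : Measurable fun y : E => ‖y - μ‖⁻¹ := by fun_prop
    fun_prop
  have hR0 : Tendsto R (𝓝 μ) (𝓝 0) := by
    rw [hasFDerivAt_iff_tendsto] at hg
    rw [tendsto_zero_iff_norm_tendsto_zero]
    refine hg.congr fun y => ?_
    simp [hR, norm_smul]
  have hRT : TendstoInMeasure P (fun n ω => R (T n ω)) atTop fun _ => (0 : F) := by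
    refine tendstoInMeasure_of_tendsto_ae
      (fun n => (hRm.comp_aemeasurable (hTm n)).aestronglyMeasurable) ?_
    filter_upwards [hT] with ω hω using hR0.comp hω
  -- Slutsky: with `u = c n • (T n - μ)`, the rescaled error of `g` is `L u + ‖u‖ • R (T n)`, and `R
  -- (T n)` tends to 0 in measure.
  have h := hTd.continuous_comp_prodMk_of_tendstoInMeasure_const
    (g := fun p : E × F => L p.1 + ‖p.1‖ • p.2) (by fun_prop) hRT
    (fun n => hRm.comp_aemeasurable (hTm n))
  simp only [smul_zero, add_zero] at h
  convert h using 3 with n ω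
  rw [norm_smul, Real.norm_of_nonneg (hc n), map_smul, mul_smul, ← smul_add]
  congr 1
  rcases eq_or_ne (T n ω) μ with h0 | h0
  · simp [h0]
  · rw [hR, smul_inv_smul₀ (norm_ne_zero_iff.2 (sub_ne_zero.2 h0))]
    abel

omit [NormedSpace ℝ E] in
lemma tendsto_measure_of_ae_tendsto_of_mem_nhds {T : ℕ → Ω → E} {θ : E}
    (hTm : ∀ n, AEMeasurable (T n) P) (hT : ∀ᵐ ω ∂P, Tendsto (fun n => T n ω) atTop (𝓝 θ))
    {U : Set E} (hU : U ∈ 𝓝 θ) :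
    Tendsto (fun n => P {ω | T n ω ∈ U}) atTop (𝓝 1) := by
  obtain ⟨ε, hε, hεU⟩ := Metric.mem_nhds_iff.1 hU
  have h := tendstoInMeasure_iff_dist.1 (tendstoInMeasure_of_tendsto_ae
    (fun n => (hTm n).aestronglyMeasurable) hT) ε hε
  have h1 : Tendsto (fun n => 1 - P {ω | ε ≤ dist (T n ω) θ}) atTop (𝓝 1) := by
    simpa using ENNReal.Tendsto.sub (tendsto_const_nhds (x := (1 : ENNReal))) h
      (Or.inl ENNReal.one_ne_top)
  refine tendsto_of_tendsto_of_tendsto_of_le_of_le h1 tendsto_const_nhds (fun n => ?_)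
    fun n => prob_le_one
  rw [tsub_le_iff_right]
  calc (1 : ENNReal) = P Set.univ := measure_univ.symm
    _ ≤ P ({ω | T n ω ∈ U} ∪ {ω | ε ≤ dist (T n ω) θ}) := by
      refine measure_mono fun ω _ => ?_
      by_cases hω : ε ≤ dist (T n ω) θ
      · exact Or.inr hω
      · exact Or.inl (hεU (not_le.1 hω))
    _ ≤ _ := measure_union_le _ _

end Delta

lemma map_toLpLin_multivariateGaussian {ι κ : Type*} [Fintype ι] [Fintype κ] [DecidableEq ι]
    [DecidableEq κ] {S : Matrix ι ι ℝ} (hS : S.PosSemidef) (G : Matrix κ ι ℝ) :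
    (multivariateGaussian 0 S).map (Matrix.toLpLin 2 2 G).toContinuousLinearMap =
      multivariateGaussian 0 (G * S * G.transpose) := by
  have hGS : (G * S * G.transpose).PosSemidef := by
    have := hS.mul_mul_conjTranspose_same G
    rwa [Matrix.conjTranspose_eq_transpose_of_trivial] at this
  apply Measure.ext_of_charFun
  ext t
  have hL : ∀ x : EuclideanSpace ℝ ι, ⟪(Matrix.toLpLin 2 2 G).toContinuousLinearMap x, t⟫ =
      ⟪x, WithLp.toLp 2 (G.transpose *ᵥ t.ofLp)⟫ := by
    intro x
    simp only [LinearMap.coe_toContinuousLinearMap', EuclideanSpace.inner_eq_star_dotProduct,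
      Matrix.ofLp_toLpLin, Matrix.toLin'_apply, star_trivial]
    rw [Matrix.dotProduct_mulVec, Matrix.mulVec_transpose]
  rw [charFun_multivariateGaussian hGS, charFun_apply,
    integral_map (by fun_prop) (by fun_prop)]
  simp_rw [hL]
  rw [← charFun_apply, charFun_multivariateGaussian hS]
  congr 2
  · simp
  · simp only
    rw [← Matrix.mulVec_mulVec, ← Matrix.mulVec_mulVec, Matrix.dotProduct_mulVec t.ofLp G,
      ← Matrix.mulVec_transpose G]

/-! ### The moments of `h` and the map `g` -/

section Moments

variable {k : ℕ}

/-- The mean of `h` under `MG_k(α, β)`. -/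
noncomputable def meanVec (α : Fin k → ℝ) (β : ℝ) : EuclideanSpace ℝ (Fin k ⊕ (Fin k ⊕ Fin k)) :=
  WithLp.toLp 2 (Sum.elim (fun i => α i * β)
    (Sum.elim (fun i => digamma (α i) + Real.log β)
      fun i => α i * β * (digamma (α i) + Real.log β) + β))

lemma measurable_hFun (k : ℕ) : Measurable (hFun k) := by
  have hd : ∀ i : Fin k, Measurable fun x : Fin k → ℝ => diff x i := fun i =>
    (measurable_pi_apply i).comp (measurable_diff k)
  refine (WithLp.measurable_toLp 2 _).comp (measurable_pi_lambda _ fun i => ?_)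
  rcases i with i | i | i
  · exact hd i
  · exact (hd i).log
  · exact (hd i).mul (hd i).log

variable [NeZero k] {α : Fin k → ℝ} {β : ℝ}

theorem memLp_hFun (hα : ∀ i, 0 < α i) (hβ : 0 < β) : MemLp (hFun k) 2 (mgamma α β) := by
  have hr := inv_pos.2 hβ
  refine MemLp.of_eval_piLp fun i => ?_
  rcases i with i | i | i
  · exact (memLp_id_gammaMeasure (hα i) hr).comp_measurePreserving
      (measurePreserving_diff_apply hα hβ i)
  · exact (memLp_log_gammaMeasure (hα i) hr).comp_measurePreserving
      (measurePreserving_diff_apply hα hβ i)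
  · exact (memLp_mul_log_gammaMeasure (hα i) hr).comp_measurePreserving
      (measurePreserving_diff_apply hα hβ i)

theorem integrable_hFun (hα : ∀ i, 0 < α i) (hβ : 0 < β) : Integrable (hFun k) (mgamma α β) := by
  have := isProbabilityMeasure_mgamma hα hβ
  exact (memLp_hFun hα hβ).integrable (by norm_num)

lemma integral_comp_diff (hα : ∀ i, 0 < α i) (hβ : 0 < β) (i : Fin k) {f : ℝ → ℝ}
    (hf : Measurable f) :
    ∫ x, f (diff x i) ∂(mgamma α β) = ∫ z, f z ∂(gammaMeasure (α i) β⁻¹) := by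
  have h := measurePreserving_diff_apply hα hβ i
  rw [← h.map_eq, integral_map h.measurable.aemeasurable hf.aestronglyMeasurable]

theorem integral_hFun (hα : ∀ i, 0 < α i) (hβ : 0 < β) :
    ∫ x, hFun k x ∂(mgamma α β) = meanVec α β := by
  have hr := inv_pos.2 hβ
  ext i
  rw [eval_integral_piLp fun i => (integrable_hFun hα hβ).eval_piLp i]
  rcases i with i | i | i
  · have h := integral_comp_diff hα hβ i (f := fun z => z) measurable_id
    rw [integral_id_gammaMeasure (hα i) hr, inv_inv] at h
    exact h
  · have h := integral_comp_diff hα hβ i Real.measurable_log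
    rw [integral_log_gammaMeasure (hα i) hr, inv_inv] at h
    exact h
  · have h := integral_comp_diff hα hβ i (f := fun z => z * Real.log z)
      (measurable_id.mul Real.measurable_log)
    rw [integral_mul_log_gammaMeasure (hα i) hr, inv_inv] at h
    exact h

/-- In each summand the product of the means cancels and leaves the covariance `β`; the average of
`k` copies is `β`. -/
lemma gLast_meanVec (α : Fin k → ℝ) (β : ℝ) : gLast (meanVec α β) = β := by
  have hk : (k : ℝ) ≠ 0 := Nat.cast_ne_zero.2 (NeZero.ne k)
  simp [gLast, meanVec, hk]

lemma gFun_meanVec (α : Fin k → ℝ) (hβ : β ≠ 0) : gFun k (meanVec α β) = param α β := by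
  rw [gFun, gLast_meanVec]
  congr 1
  ext i
  simp [meanVec, hβ]

end Moments

/-! ### Smoothness and Jacobian of `g` -/

section Derivative

variable {k : ℕ}

/-- No support condition is needed: both sides use the same default values of `log`, of division by
zero and of the empty mean. -/
lemma same_eq_gFun (n : ℕ) (x : Fin n → Fin k → ℝ) :
    same k n x = gFun k (sampleMean (hFun k) x) := by
  have h1 : ∀ j, sampleMean (hFun k) x (Sum.inl j) = sampleMean (fun y => diff y j) x := by
    intro j; simp [sampleMean, hFun]
  have h2 : ∀ j, sampleMean (hFun k) x (Sum.inr (Sum.inl j)) =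
      sampleMean (fun y => Real.log (diff y j)) x := by
    intro j; simp [sampleMean, hFun]
  have h3 : ∀ j, sampleMean (hFun k) x (Sum.inr (Sum.inr j)) =
      sampleMean (fun y => diff y j * Real.log (diff y j)) x := by
    intro j; simp [sampleMean, hFun]
  have hb : gLast (sampleMean (hFun k) x) = betaSAME x := by
    simp only [gLast, h1, h2, h3, betaSAME]
  rw [same, gFun, hb]
  congr 1
  ext i
  rw [h1, alphaSAME]

lemma contDiff_gLast : ContDiff ℝ 1
    (gLast : EuclideanSpace ℝ (Fin k ⊕ (Fin k ⊕ Fin k)) → ℝ) := by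
  unfold gLast
  fun_prop

lemma contDiffAt_gFun {y : EuclideanSpace ℝ (Fin k ⊕ (Fin k ⊕ Fin k))} (hy : gLast y ≠ 0) :
    ContDiffAt ℝ 1 (gFun k) y := by
  rw [contDiffAt_euclidean]
  rintro (i | i)
  · exact ContDiffAt.div (by fun_prop) contDiff_gLast.contDiffAt hy
  · exact contDiff_gLast.contDiffAt

lemma measurable_gFun (k : ℕ) : Measurable (gFun k) := by
  have hg : Measurable (gLast : EuclideanSpace ℝ (Fin k ⊕ (Fin k ⊕ Fin k)) → ℝ) :=
    contDiff_gLast.continuous.measurable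
  refine (WithLp.measurable_toLp 2 _).comp (measurable_pi_lambda _ fun i => ?_)
  rcases i with i | i
  · exact Measurable.div (by fun_prop) hg
  · exact hg

lemma hasFDerivAt_gLast (y : EuclideanSpace ℝ (Fin k ⊕ (Fin k ⊕ Fin k))) :
    HasFDerivAt gLast ((1 / (k : ℝ)) • ∑ j : Fin k,
      ((EuclideanSpace.proj (Sum.inr (Sum.inr j)) : _ →L[ℝ] ℝ) -
        (y (Sum.inl j) • (EuclideanSpace.proj (Sum.inr (Sum.inl j)) : _ →L[ℝ] ℝ) +
          y (Sum.inr (Sum.inl j)) • (EuclideanSpace.proj (Sum.inl j) : _ →L[ℝ] ℝ)))) y := by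
  have hp : ∀ i, HasFDerivAt
      (fun y : EuclideanSpace ℝ (Fin k ⊕ (Fin k ⊕ Fin k)) => y i)
      (EuclideanSpace.proj i : _ →L[ℝ] ℝ) y := fun i =>
    (EuclideanSpace.proj i : EuclideanSpace ℝ (Fin k ⊕ (Fin k ⊕ Fin k)) →L[ℝ] ℝ).hasFDerivAt
  exact (HasFDerivAt.fun_sum fun (j : Fin k) _ => (hp (Sum.inr (Sum.inr j))).fun_sub
    ((hp (Sum.inl j)).fun_mul (hp (Sum.inr (Sum.inl j))))).const_mul (1 / (k : ℝ))

lemma GMat_inr_apply (α : Fin k → ℝ) (β : ℝ) (v : EuclideanSpace ℝ (Fin k ⊕ (Fin k ⊕ Fin k))) :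
    Matrix.toLpLin 2 2 (GMat α β) v (Sum.inr ()) = 1 / (k : ℝ) * ∑ j : Fin k,
      (v (Sum.inr (Sum.inr j)) - (α j * β * v (Sum.inr (Sum.inl j)) +
        (digamma (α j) + Real.log β) * v (Sum.inl j))) := by
  simp only [Matrix.ofLp_toLpLin, Matrix.toLin'_apply, Matrix.mulVec, dotProduct, GMat,
    Fintype.sum_sum_type, Matrix.fromBlocks_apply₂₁, Matrix.fromBlocks_apply₂₂,
    Matrix.fromCols_apply_inl, Matrix.fromCols_apply_inr, Matrix.of_apply]
  rw [← Finset.sum_add_distrib, ← Finset.sum_add_distrib, Finset.mul_sum]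
  exact Finset.sum_congr rfl fun j _ => by ring

variable [NeZero k]

/-- The quotient rule for `y i / gLast y` at `y i = α i * β`, `gLast y = β`: the upper rows of
`GMat` are determined by its last row. -/
lemma GMat_inl_apply (α : Fin k → ℝ) {β : ℝ} (hβ : β ≠ 0)
    (v : EuclideanSpace ℝ (Fin k ⊕ (Fin k ⊕ Fin k))) (i : Fin k) :
    Matrix.toLpLin 2 2 (GMat α β) v (Sum.inl i) = v (Sum.inl i) / β -
      α i / β * Matrix.toLpLin 2 2 (GMat α β) v (Sum.inr ()) := by
  have hk : (k : ℝ) ≠ 0 := Nat.cast_ne_zero.2 (NeZero.ne k)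
  have h1 : v (Sum.inl i) / β = ∑ j, (if i = j then 1 / β else 0) * v (Sum.inl j) := by
    simp [div_eq_inv_mul]
  rw [GMat_inr_apply, h1]
  simp only [Matrix.ofLp_toLpLin, Matrix.toLin'_apply, Matrix.mulVec, dotProduct, GMat,
    Fintype.sum_sum_type, Matrix.fromBlocks_apply₁₁, Matrix.fromBlocks_apply₁₂,
    Matrix.fromCols_apply_inl, Matrix.fromCols_apply_inr, Matrix.of_apply]
  rw [← Finset.sum_add_distrib, ← Finset.sum_add_distrib, Finset.mul_sum, Finset.mul_sum,
    ← Finset.sum_sub_distrib]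
  refine Finset.sum_congr rfl fun j _ => ?_
  field_simp
  ring

theorem hasFDerivAt_gFun (α : Fin k → ℝ) {β : ℝ} (hβ : β ≠ 0) :
    HasFDerivAt (gFun k) (Matrix.toLpLin 2 2 (GMat α β)).toContinuousLinearMap (meanVec α β) := by
  have hlast : HasFDerivAt gLast
      ((EuclideanSpace.proj (Sum.inr ()) : _ →L[ℝ] ℝ) ∘L
        (Matrix.toLpLin 2 2 (GMat α β)).toContinuousLinearMap) (meanVec α β) := by
    convert hasFDerivAt_gLast (meanVec α β) using 1
    ext v
    simpa [meanVec] using GMat_inr_apply α β v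
  rw [← hasFDerivWithinAt_univ, hasFDerivWithinAt_euclidean]
  simp only [hasFDerivWithinAt_univ]
  rintro (i | i)
  · have hi : HasFDerivAt (fun y : EuclideanSpace ℝ (Fin k ⊕ (Fin k ⊕ Fin k)) => y (Sum.inl i))
        (EuclideanSpace.proj (Sum.inl i) : _ →L[ℝ] ℝ) (meanVec α β) :=
      (EuclideanSpace.proj (Sum.inl i) :
        EuclideanSpace ℝ (Fin k ⊕ (Fin k ⊕ Fin k)) →L[ℝ] ℝ).hasFDerivAt
    have hg : gLast (meanVec α β) ≠ 0 := by rwa [gLast_meanVec]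
    refine HasFDerivAt.congr_fderiv
      (hi.fun_mul ((hasDerivAt_inv hg).comp_hasFDerivAt (meanVec α β) hlast)) ?_
    ext v
    have := GMat_inl_apply α hβ v i
    simp only [gLast_meanVec]
    simp [meanVec] at this ⊢
    rw [this]
    field_simp
    ring
  · exact hlast

end Derivative

/-! ### The parameter space and the moment-type property -/

section Parameters

variable {k : ℕ}

lemma param_mem_paramSpace {α : Fin k → ℝ} {β : ℝ} (hα : ∀ i, 0 < α i) (hβ : 0 < β) :
    param α β ∈ paramSpace k := by
  rintro (i | i)
  exacts [hα i, hβ]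

lemma param_eq_self (θ : EuclideanSpace ℝ (Fin k ⊕ Unit)) :
    param (fun i => θ (Sum.inl i)) (θ (Sum.inr ())) = θ := by
  ext (i | i) <;> rfl

lemma isOpen_paramSpace (k : ℕ) : IsOpen (paramSpace k) := by
  have : paramSpace k = ⋂ i, {θ | 0 < θ i} := by ext; simp [paramSpace]
  rw [this]
  exact isOpen_iInter_of_finite fun i => isOpen_lt continuous_const (by fun_prop)

end Parameters

theorem isMomentTypeEstimator_same (k : ℕ) [NeZero k] :
    IsMomentTypeEstimator (family k) (support k) (paramSpace k) (hFun k) (gFun k) (same k) := by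
  have hinv : ∀ θ ∈ paramSpace k, gFun k (∫ x, hFun k x ∂(family k θ)) = θ := fun θ hθ => by
    rw [family, integral_hFun (fun i => hθ _) (hθ _), gFun_meanVec _ (hθ _).ne', param_eq_self]
  exact
    { isProbabilityMeasure := fun θ hθ => isProbabilityMeasure_mgamma (fun i => hθ _) (hθ _)
      ae_mem_support := fun θ _ => ae_mem_support_mgamma _ _
      integrable := fun θ hθ => integrable_hFun (fun i => hθ _) (hθ _)
      injOn := Set.LeftInvOn.injOn hinv
      leftInverse := hinv
      estimator_eq := fun n x _ => same_eq_gFun n x }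

lemma sampleMean_eq_range {k : ℕ} {Ω : Type*} (X : ℕ → Ω → Fin k → ℝ) (n : ℕ) (ω : Ω) :
    (sampleMean (hFun k) fun l : Fin n => X l ω) =
      (n : ℝ)⁻¹ • ∑ l ∈ Finset.range n, hFun k (X l ω) := by
  rw [sampleMean, Fin.sum_univ_eq_sum_range fun l => hFun k (X l ω)]

/-! ### Consistency and asymptotic normality of the estimator -/

section Sample

variable {k : ℕ} {α : Fin k → ℝ} {β : ℝ} {Ω : Type*} [MeasurableSpace Ω]
  {P : Measure Ω} {X : ℕ → Ω → Fin k → ℝ}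

lemma aemeasurable_sampleMean_hFun (hX : ∀ n, AEMeasurable (X n) P) (n : ℕ) :
    AEMeasurable (fun ω => sampleMean (hFun k) fun l : Fin n => X l ω) P := by
  simp_rw [sampleMean_eq_range X]
  exact (Finset.aemeasurable_fun_sum _ fun l _ =>
    (measurable_hFun k).comp_aemeasurable (hX l)).fun_const_smul _

lemma identDistrib_hFun {μ : Measure (Fin k → ℝ)} (hX : ∀ n, HasLaw (X n) μ P) (i : ℕ) :
    IdentDistrib (fun ω => hFun k (X i ω)) (fun ω => hFun k (X 0 ω)) P P :=
  IdentDistrib.comp (f := X i) (g := X 0) (u := hFun k) ⟨(hX i).aemeasurable,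
    (hX 0).aemeasurable, (hX i).map_eq.trans (hX 0).map_eq.symm⟩ (measurable_hFun k)

lemma covMat_hFun_sample {μ : Measure (Fin k → ℝ)} (hX : HasLaw (X 0) μ P) :
    covMat P (fun ω => hFun k (X 0 ω)) = covMat μ (hFun k) := by
  have hm : ∀ a, AEMeasurable (fun x => hFun k x a) μ := fun a =>
    ((EuclideanSpace.proj a : _ →L[ℝ] ℝ).continuous.measurable.comp
      (measurable_hFun k)).aemeasurable
  ext a b
  exact hX.covariance_fun_comp (hm a) (hm b)

variable [NeZero k]

lemma integral_hFun_sample (hα : ∀ i, 0 < α i) (hβ : 0 < β)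
    (hX : HasLaw (X 0) (mgamma α β) P) : ∫ ω, hFun k (X 0 ω) ∂P = meanVec α β := by
  rw [← integral_hFun hα hβ]
  exact hX.integral_comp (measurable_hFun k).aestronglyMeasurable

lemma memLp_hFun_sample (hα : ∀ i, 0 < α i) (hβ : 0 < β)
    (hX : HasLaw (X 0) (mgamma α β) P) : MemLp (fun ω => hFun k (X 0 ω)) 2 P := by
  refine MemLp.comp_of_map (g := hFun k) ?_ hX.aemeasurable
  rw [hX.map_eq]
  exact memLp_hFun hα hβ

variable [IsProbabilityMeasure P]

lemma ae_tendsto_sampleMean_hFun (hα : ∀ i, 0 < α i) (hβ : 0 < β)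
    (hX : ∀ n, HasLaw (X n) (mgamma α β) P) (hind : iIndepFun X P) :
    ∀ᵐ ω ∂P, Tendsto (fun n : ℕ => sampleMean (hFun k) fun l : Fin n => X l ω) atTop
      (𝓝 (meanVec α β)) := by
  have h := strong_law_ae (fun n ω => hFun k (X n ω))
    ((memLp_hFun_sample hα hβ (hX 0)).integrable (by norm_num))
    (fun i j hij => (hind.indepFun hij).comp (measurable_hFun k) (measurable_hFun k))
    (identDistrib_hFun hX)
  simp only [integral_hFun_sample hα hβ (hX 0)] at h
  simpa only [sampleMean_eq_range] using h

theorem tendsto_measure_same_mem_paramSpace (hα : ∀ i, 0 < α i) (hβ : 0 < β)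
    (hX : ∀ n, HasLaw (X n) (mgamma α β) P) (hind : iIndepFun X P) :
    Tendsto (fun n : ℕ => P {ω | same k n (fun l : Fin n => X l ω) ∈ paramSpace k})
      atTop (𝓝 1) := by
  simp_rw [same_eq_gFun]
  refine tendsto_measure_of_ae_tendsto_of_mem_nhds (θ := param α β) (fun n =>
    (measurable_gFun k).comp_aemeasurable
      (aemeasurable_sampleMean_hFun (fun n => (hX n).aemeasurable) n)) ?_
    ((isOpen_paramSpace k).mem_nhds (param_mem_paramSpace hα hβ))
  -- By continuity of `g` at the mean, the strong law makes the estimator converge almost surely to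
  -- a point of the open parameter space.
  have hg := (hasFDerivAt_gFun α hβ.ne').continuousAt.tendsto
  rw [gFun_meanVec _ hβ.ne'] at hg
  filter_upwards [ae_tendsto_sampleMean_hFun hα hβ hX hind] with ω hω using hg.comp hω

theorem isAsymptoticallyNormal_same (hα : ∀ i, 0 < α i) (hβ : 0 < β)
    (hX : ∀ n, HasLaw (X n) (mgamma α β) P) (hind : iIndepFun X P) :
    IsAsymptoticallyNormal P (fun n ω => same k n (fun l : Fin n => X l ω)) (param α β)
      (GMat α β * covMat (mgamma α β) (hFun k) * (GMat α β).transpose) := by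
  have := isProbabilityMeasure_mgamma hα hβ
  have hclt := tendstoInDistribution_inv_sqrt_smul_sum_sub (P := P)
    (Y := fun n ω => hFun k (X n ω)) (memLp_hFun_sample hα hβ (hX 0)) (hind.comp (fun _ => hFun k) fun _ => measurable_hFun k)
    (identDistrib_hFun hX)
  rw [integral_hFun_sample hα hβ (hX 0)] at hclt
  -- Passage from the normalized sum to `√n` times the centred mean; at `n = 0` both are 0.
  have hmean : (fun (n : ℕ) ω => (√(n : ℝ))⁻¹ •
      (∑ l ∈ Finset.range n, hFun k (X l ω) - (n : ℝ) • meanVec α β)) =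
      fun (n : ℕ) ω => √(n : ℝ) •
        ((sampleMean (hFun k) fun l : Fin n => X l ω) - meanVec α β) := by
    ext1 n
    ext1 ω
    rcases Nat.eq_zero_or_pos n with rfl | hn
    · simp
    have hn : (0 : ℝ) < n := Nat.cast_pos.2 hn
    rw [sampleMean_eq_range, smul_sub, smul_sub, smul_smul, smul_smul]
    congr 2
    · rw [← div_eq_mul_inv, Real.sqrt_div_self', one_div]
    · rw [inv_mul_eq_div, Real.div_sqrt]
  rw [hmean] at hclt
  have hdelta := tendstoInDistribution_of_hasFDerivAt (hasFDerivAt_gFun α hβ.ne')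
    (measurable_gFun k) (aemeasurable_sampleMean_hFun fun n => (hX n).aemeasurable)
    (ae_tendsto_sampleMean_hFun hα hβ hX hind) (fun n => Real.sqrt_nonneg _) hclt
  rw [gFun_meanVec _ hβ.ne'] at hdelta
  have hlaw := map_toLpLin_multivariateGaussian (posSemidef_covMat (memLp_hFun hα hβ)) (GMat α β)
  unfold IsAsymptoticallyNormal
  simp_rw [same_eq_gFun]
  refine ⟨hdelta.forall_aemeasurable, aemeasurable_id, ?_⟩
  convert hdelta.tendsto using 1
  -- The limit laws agree because the image of `N(0, V)` under `G` is `N(0, G V Gᵀ)`.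
  refine congrArg 𝓝 (Subtype.ext ?_)
  refine Measure.map_id.trans ?_
  rw [← hlaw, ← covMat_hFun_sample (hX 0)]
  rfl

end Sample

end MGamma

open MGamma
theorem mainTheorem2 (k : ℕ) [NeZero k] :
    IsMomentTypeEstimator (family k) (support k) (paramSpace k) (hFun k) (gFun k) (same k) ∧
    ∀ (α : Fin k → ℝ) (β : ℝ), (∀ i, 0 < α i) → 0 < β →
      MemLp (hFun k) 2 (mgamma α β) ∧
      ContDiffAt ℝ 1 (gFun k) (∫ x, hFun k x ∂(mgamma α β)) ∧
      HasFDerivAt (gFun k) (Matrix.toLpLin 2 2 (GMat α β)).toContinuousLinearMap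
        (∫ x, hFun k x ∂(mgamma α β)) ∧
      ∀ {Ω : Type*} [MeasurableSpace Ω] (P : Measure Ω) [IsProbabilityMeasure P]
        (X : ℕ → Ω → Fin k → ℝ), (∀ n, HasLaw (X n) (mgamma α β) P) → iIndepFun X P →
        Tendsto (fun n : ℕ => P {ω | same k n (fun l : Fin n => X l ω) ∈ paramSpace k})
          atTop (𝓝 1) ∧
        IsAsymptoticallyNormal P (fun n ω => same k n (fun l : Fin n => X l ω)) (param α β)
          (GMat α β * covMat (mgamma α β) (hFun k) * (GMat α β).transpose) := by
  refine ⟨isMomentTypeEstimator_same k, fun α β hα hβ => ⟨memLp_hFun hα hβ, ?_, ?_, ?_⟩⟩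
  · rw [integral_hFun hα hβ]
    exact contDiffAt_gFun (by rw [gLast_meanVec]; exact hβ.ne')
  · rw [integral_hFun hα hβ]
    exact hasFDerivAt_gFun α hβ.ne'
  · intro Ω _ P _ X hX hind
    exact ⟨tendsto_measure_same_mem_paramSpace hα hβ hX hind,
      isAsymptoticallyNormal_same hα hβ hX hind⟩
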